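/- A digraph $D$ is a set of vertices with a set of ordered pairs of vertices, its edges, without loops; here $D$ is infinite, and connected (as an undirected graph). An $s$-arc from $u$ to $v$ is a sequence $u=u_0,u_1,\dots,u_s=v$ of vertices with $(u_i,u_{i+1})$ an edge for $0\le i<s$ and $u_{i-1}\ne u_{i+1}$ for $0<i<s$. Let $D^s(u)$ be the set of vertices reached by an $s$-arc from $u$, let $\mathrm{desc}(u)=\bigcup_{s\ge 0}D^s(u)$, and let $\mathrm{desc}(X)=\bigcup_{x\in X}\mathrm{desc}(x)$ for a set $X$ of vertices. Descendant sets are regarded as full induced subdigraphs. $D$ is distance-transitive if for every $s\ge 0$ the group $\mathrm{Aut}(D)$ is transitive on the pairs $(u,v)$ for which there is an $s$-arc, but no $t$-arc with $t<s$, from $u$ to $v$. $D$ is weakly descendant-homogeneous if it is vertex transitive and, for any finite sets $X,Y$ of vertices and any isomorphism $f$ from $\mathrm{desc}(X)$ to $\mathrm{desc}(Y)$, some automorphism of $D$ agrees with $f$ on $X$. An alternating walk is a sequence $x_0,x_1,\dots,x_n$ of vertices such that either $(x_{2i-1},x_{2i})$ and $(x_{2i+1},x_{2i})$ are edges for all $i$,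 or $(x_{2i},x_{2i-1})$ and $(x_{2i},x_{2i+1})$ are edges for all $i$ (whenever the indices lie between $0$ and $n$). An edge $e'$ is reachable from an edge $e$ if there is an alternating walk $x_0,\dots,x_n$, $n\ge 1$, with $e=(x_0,x_1)$ and $e'=(x_{n-1},x_n)$ or $e'=(x_n,x_{n-1})$; the reachability relation is universal if every edge is reachable from every edge. $D$ has property $Z$ if there is a surjective map $f$ from the vertex set of $D$ to $\mathbb{Z}$ such that $f(v)=f(u)+1$ for every edge $(u,v)$. Theorem. Let $D$ be an infinite, connected digraph that is distance-transitive and weakly descendant-homogeneous, with finite out-valency $m>0$ and no directed cycles. Suppose that the descendant subdigraph $\Gamma=\mathrm{desc}(\alpha)$ of $D$, where $\alpha$ is a vertex (by vertex transitivity, the choice of $\alpha$ does not matter), satisfies P3: $|\Gamma^i(\alpha)|<|\Gamma^{i+1}(\alpha)|$ for every integer $i\ge 0$, where $\Gamma^i(\alpha)$ is the set of vertices reached from $\alpha$ by an $i$-arc in $\Gamma$. Then every vertex of $D$ has infinite in-valency, the reachability relation on the edges of $D$ is universal, and $D$ does not have property $Z$. -/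

import Mathlib

namespace Digraph

/-- Isomorphisms of digraphs: bijections of the vertex sets preserving edges in both directions. -/
abbrev Iso {V W : Type*} (D : Digraph V) (D' : Digraph W) : Type _ := D.Adj ≃r D'.Adj

/-- Automorphisms of a digraph. -/
abbrev Aut {V : Type*} (D : Digraph V) : Type _ := D.Iso D

/-- The full induced subdigraph on a set of vertices. -/
def induce {V : Type*} (D : Digraph V) (S : Set V) : Digraph S where
  Adj u v := D.Adj u v

/-- The set of out-neighbours of a vertex. -/
def outNeighbors {V : Type*} (D : Digraph V) (v : V) : Set V := {u | D.Adj v u}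

/-- The set of in-neighbours of a vertex. -/
def inNeighbors {V : Type*} (D : Digraph V) (v : V) : Set V := {u | D.Adj u v}

/-- Every vertex has exactly `m` out-neighbours. -/
def HasOutValency {V : Type*} (D : Digraph V) (m : ℕ) : Prop :=
  ∀ v, (D.outNeighbors v).encard = m

/-- Every vertex has infinitely many in-neighbours. -/
def HasInfiniteInValency {V : Type*} (D : Digraph V) : Prop :=
  ∀ v, (D.inNeighbors v).Infinite

/-- Connectedness, in the sense of the underlying undirected graph. -/
def IsConnected {V : Type*} (D : Digraph V) : Prop := D.toSimpleGraphInclusive.Connected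

/-- There is no closed directed walk of positive length, hence no directed cycle
(loops and pairs of opposite edges count as directed cycles). -/
def NoDirectedCycles {V : Type*} (D : Digraph V) : Prop :=
  ∀ v, ¬ Relation.TransGen D.Adj v v

/-- The initial segment `u 0, u 1, …, u s` is an `s`-arc: consecutive vertices are joined by
an edge, and `u (j - 1) ≠ u (j + 1)` for `0 < j < s`. Values of `u` beyond `s` are irrelevant. -/
def IsArc {V : Type*} (D : Digraph V) (s : ℕ) (u : ℕ → V) : Prop :=
  (∀ i, i < s → D.Adj (u i) (u (i + 1))) ∧ ∀ i, i + 1 < s → u i ≠ u (i + 2)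

/-- The set of vertices which can be reached by an `s`-arc from `v`. -/
def layer {V : Type*} (D : Digraph V) (s : ℕ) (v : V) : Set V :=
  {w | ∃ u : ℕ → V, D.IsArc s u ∧ u 0 = v ∧ u s = w}

/-- The descendant set of a vertex. -/
def desc {V : Type*} (D : Digraph V) (v : V) : Set V := ⋃ s : ℕ, D.layer s v

/-- The descendant set of a set of vertices. -/
def descSet {V : Type*} (D : Digraph V) (X : Set V) : Set V := ⋃ x ∈ X, D.desc x

theorem mem_desc_self {V : Type*} (D : Digraph V) (v : V) : v ∈ D.desc v :=
  Set.mem_iUnion.2 ⟨0, fun _ => v, ⟨fun _ h => absurd h (by omega), fun _ h => absurd h (by omega)⟩,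
    rfl, rfl⟩

theorem mem_descSet_of_mem {V : Type*} (D : Digraph V) {X : Set V} {x : V} (hx : x ∈ X) :
    x ∈ D.descSet X :=
  Set.mem_biUnion hx (D.mem_desc_self x)

/-- The descendant subdigraph of a vertex. -/
def descSubdigraph {V : Type*} (D : Digraph V) (v : V) : Digraph (D.desc v) :=
  D.induce (D.desc v)

/-- The root of the descendant subdigraph of `v`. -/
def descRoot {V : Type*} (D : Digraph V) (v : V) : D.desc v := ⟨v, D.mem_desc_self v⟩

/-- Property P3 of a digraph with root `a`: the successive layers below the root
strictly increase in size. -/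
def P3 {W : Type*} (Γ : Digraph W) (a : W) : Prop :=
  ∀ i : ℕ, (Γ.layer i a).encard < (Γ.layer (i + 1) a).encard

/-- The automorphism group acts transitively on vertices. -/
def IsVertexTransitive {V : Type*} (D : Digraph V) : Prop :=
  ∀ u v : V, ∃ g : D.Aut, g u = v

/-- There is an `s`-arc from `u` to `v`, but no `t`-arc for `t < s`. -/
def AtDistance {V : Type*} (D : Digraph V) (s : ℕ) (u v : V) : Prop :=
  v ∈ D.layer s u ∧ ∀ t, t < s → v ∉ D.layer t u

/-- For every `s`, the automorphism group acts transitively on the pairs `(u, v)` such that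
`v` is at directed distance `s` from `u`. -/
def IsDistanceTransitive {V : Type*} (D : Digraph V) : Prop :=
  ∀ (s : ℕ) (u v u' v' : V), D.AtDistance s u v → D.AtDistance s u' v' →
    ∃ g : D.Aut, g u = u' ∧ g v = v'

/-- Weak descendant-homogeneity: vertex transitivity, and for every isomorphism `f` between the
subdigraphs induced on the descendant sets of two finite sets `X` and `Y` of vertices there is
an automorphism agreeing with `f` on `X`. -/
def IsWeaklyDescendantHomogeneous {V : Type*} (D : Digraph V) : Prop :=
  D.IsVertexTransitive ∧
    ∀ X Y : Set V, X.Finite → Y.Finite →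
      ∀ f : (D.induce (D.descSet X)).Iso (D.induce (D.descSet Y)),
        ∃ g : D.Aut, ∀ (x : V) (hx : x ∈ X), g x = f ⟨x, D.mem_descSet_of_mem hx⟩

/-- The initial segment `x 0, x 1, …, x n` is an alternating walk: the edges joining consecutive
vertices alternate in direction, beginning either with a forward or with a backward one.
Values of `x` beyond `n` are irrelevant. -/
def IsAlternatingWalk {V : Type*} (D : Digraph V) (n : ℕ) (x : ℕ → V) : Prop :=
  (∀ i, i < n → (Even i → D.Adj (x i) (x (i + 1))) ∧ (Odd i → D.Adj (x (i + 1)) (x i))) ∨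
  (∀ i, i < n → (Even i → D.Adj (x (i + 1)) (x i)) ∧ (Odd i → D.Adj (x i) (x (i + 1))))

/-- The edge `(c, d)` is reachable from the edge `(a, b)`: there is an alternating walk
`x 0, …, x (n + 1)` with `(a, b) = (x 0, x 1)`, whose last two vertices are `c` and `d`,
in either order. -/
def Reachable {V : Type*} (D : Digraph V) (a b c d : V) : Prop :=
  ∃ (n : ℕ) (x : ℕ → V), D.IsAlternatingWalk (n + 1) x ∧ a = x 0 ∧ b = x 1 ∧
    ((c = x n ∧ d = x (n + 1)) ∨ (c = x (n + 1) ∧ d = x n))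

/-- Any edge is reachable from any edge. -/
def ReachabilityIsUniversal {V : Type*} (D : Digraph V) : Prop :=
  ∀ a b c d : V, D.Adj a b → D.Adj c d → D.Reachable a b c d

/-- The two-way infinite directed line: vertex set `ℤ`, edges `(i, i + 1)`. -/
def line : Digraph ℤ where
  Adj i j := j = i + 1

/-- Property Z: there is a homomorphism onto the two-way infinite directed line. -/
def HasPropertyZ {V : Type*} (D : Digraph V) : Prop :=
  ∃ f : D.Adj →r line.Adj, Function.Surjective f

end Digraph

/-! Distance-transitivity and acyclicity make the layers below a vertex disjoint, and the number of
parents that a vertex of layer `n + 1` below `u` has in layer `n` depends on `n` only. This number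
is nondecreasing, and at most `m` because layers grow (P3), so it is constant from some depth `k`
on. From there, climbing from a common descendant of two children of `u` cannot leave the layers of
either child before depth `k`. As the layer at depth `k + 1` below `u` is larger than the layer at
depth `k` below one child `x`, some `z` has `desc x` and `desc z` disjoint.

Descendant sets are closed under out-edges, so disjoint ones have no edges between them and
automorphisms can be prescribed on them independently (`exists_aut_glue`). In particular the
stabiliser of `x` moves `z` to any descendant of `z`; this excludes property Z and finite
in-valency.

Universality needs more: vertices `x`, `y` with disjoint descendant sets that are heads of
equivalent edges. Fixing `x` and moving `y` to a child then makes two consecutive edges equivalent,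
hence all edges. Such a pair comes from two siblings by repeatedly shrinking their overlap at depth
`k` (`exists_separatedAt_ncard_lt`). -/

namespace Digraph

variable {V : Type*} {D : Digraph V}

/-! ### Directed walks, layers and descendant sets -/

/-- The set of vertices reached from a vertex by a directed walk with `n` edges. -/
def walkLayer {V : Type*} (D : Digraph V) : ℕ → V → Set V
  | 0, v => {v}
  | n + 1, v => {w | ∃ p ∈ D.walkLayer n v, D.Adj p w}

@[simp] theorem mem_walkLayer_zero {u w : V} : w ∈ D.walkLayer 0 u ↔ w = u := Iff.rfl

theorem mem_walkLayer_succ {n : ℕ} {u w : V} :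
    w ∈ D.walkLayer (n + 1) u ↔ ∃ p ∈ D.walkLayer n u, D.Adj p w := Iff.rfl

theorem mem_walkLayer_one {u w : V} : w ∈ D.walkLayer 1 u ↔ D.Adj u w := by
  simp [mem_walkLayer_succ]

theorem mem_walkLayer_add {s t : ℕ} {u w : V} :
    w ∈ D.walkLayer (s + t) u ↔ ∃ p ∈ D.walkLayer s u, w ∈ D.walkLayer t p := by
  induction t generalizing w with
  | zero => simp
  | succ t ih =>
    rw [← add_assoc, mem_walkLayer_succ]
    constructor
    · rintro ⟨q, hq, hqw⟩
      obtain ⟨p, hp, hpq⟩ := ih.1 hq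
      exact ⟨p, hp, q, hpq, hqw⟩
    · rintro ⟨p, hp, q, hq, hqw⟩
      exact ⟨q, ih.2 ⟨p, hp, hq⟩, hqw⟩

theorem mem_walkLayer_add_of_mem {s t : ℕ} {u p w : V} (hp : p ∈ D.walkLayer s u)
    (hw : w ∈ D.walkLayer t p) : w ∈ D.walkLayer (s + t) u :=
  mem_walkLayer_add.2 ⟨p, hp, hw⟩

theorem mem_walkLayer_succ_of_adj {n : ℕ} {u x w : V} (hx : D.Adj u x)
    (hw : w ∈ D.walkLayer n x) : w ∈ D.walkLayer (n + 1) u := by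
  rw [add_comm]
  exact mem_walkLayer_add_of_mem (mem_walkLayer_one.2 hx) hw

theorem mem_walkLayer_succ_iff {n : ℕ} {u w : V} :
    w ∈ D.walkLayer (n + 1) u ↔ ∃ x, D.Adj u x ∧ w ∈ D.walkLayer n x := by
  rw [add_comm, mem_walkLayer_add]
  simp [mem_walkLayer_one]

theorem map_mem_walkLayer (g : D.Aut) {n : ℕ} {u w : V} :
    g w ∈ D.walkLayer n (g u) ↔ w ∈ D.walkLayer n u := by
  induction n generalizing w with
  | zero => simp
  | succ n ih =>
    constructor
    · rintro ⟨p, hp, hpw⟩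
      obtain ⟨p, rfl⟩ := g.surjective p
      exact ⟨p, ih.1 hp, g.map_rel_iff.1 hpw⟩
    · rintro ⟨p, hp, hpw⟩
      exact ⟨g p, ih.2 hp, g.map_rel_iff.2 hpw⟩

theorem image_walkLayer (g : D.Aut) (n : ℕ) (u : V) :
    g '' D.walkLayer n u = D.walkLayer n (g u) := by
  ext w
  obtain ⟨w, rfl⟩ := g.surjective w
  simp [map_mem_walkLayer]

theorem transGen_of_mem_walkLayer {n : ℕ} {u w : V} (h : w ∈ D.walkLayer (n + 1) u) :
    Relation.TransGen D.Adj u w := by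
  induction n generalizing w with
  | zero => exact .single (mem_walkLayer_one.1 h)
  | succ n ih =>
    obtain ⟨p, hp, hpw⟩ := h
    exact (ih hp).tail hpw

theorem exists_walk_of_mem_walkLayer {n : ℕ} {u w : V} (h : w ∈ D.walkLayer n u) :
    ∃ x : ℕ → V, (∀ i, i < n → D.Adj (x i) (x (i + 1))) ∧ x 0 = u ∧ x n = w := by
  induction n generalizing w with
  | zero => exact ⟨fun _ => u, by simp, rfl, (mem_walkLayer_zero.1 h).symm⟩
  | succ n ih =>
    obtain ⟨p, hp, hpw⟩ := h
    obtain ⟨x, hx, h0, hn⟩ := ih hp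
    refine ⟨fun i => if i ≤ n then x i else w, fun i hi => ?_, by simpa using h0, by simp⟩
    rcases Nat.lt_succ_iff_lt_or_eq.1 hi with h | rfl
    · simpa [h.le, Nat.succ_le_of_lt h] using hx i h
    · simpa [hn] using hpw

/-- Without directed cycles a directed walk never returns after two steps, so the arc condition is
automatic. -/
theorem layer_eq_walkLayer (hacyc : D.NoDirectedCycles) (n : ℕ) (u : V) :
    D.layer n u = D.walkLayer n u := by
  ext w
  constructor
  · rintro ⟨x, ⟨hx, -⟩, rfl, rfl⟩
    have key : ∀ i, i ≤ n → x i ∈ D.walkLayer i (x 0) := by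
      intro i
      induction i with
      | zero => simp
      | succ i ih => exact fun hi => ⟨x i, ih (by omega), hx i (by omega)⟩
    exact key n le_rfl
  · intro h
    obtain ⟨x, hx, h0, hn⟩ := exists_walk_of_mem_walkLayer h
    refine ⟨x, ⟨hx, fun i hi he => hacyc (x i) ?_⟩, h0, hn⟩
    have h2 := hx (i + 1) hi
    rw [add_assoc, ← he] at h2
    exact (Relation.TransGen.single (hx i (by omega))).tail h2

theorem mem_desc_iff (hacyc : D.NoDirectedCycles) {u w : V} :
    w ∈ D.desc u ↔ ∃ n, w ∈ D.walkLayer n u := by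
  simp [desc, layer_eq_walkLayer hacyc]

theorem desc_closed (hacyc : D.NoDirectedCycles) {u v w : V} (hv : v ∈ D.desc u)
    (hw : w ∈ D.desc v) : w ∈ D.desc u := by
  rw [mem_desc_iff hacyc] at *
  obtain ⟨s, hs⟩ := hv
  obtain ⟨t, ht⟩ := hw
  exact ⟨s + t, mem_walkLayer_add_of_mem hs ht⟩

theorem desc_subset_desc (hacyc : D.NoDirectedCycles) {u v : V} (hv : v ∈ D.desc u) :
    D.desc v ⊆ D.desc u := fun _ => desc_closed hacyc hv

theorem mem_desc_of_adj (hacyc : D.NoDirectedCycles) {u v : V} (h : D.Adj u v) :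
    v ∈ D.desc u := (mem_desc_iff hacyc).2 ⟨1, mem_walkLayer_one.2 h⟩

theorem map_mem_desc (hacyc : D.NoDirectedCycles) (g : D.Aut) {u w : V} :
    g w ∈ D.desc (g u) ↔ w ∈ D.desc u := by
  simp [mem_desc_iff hacyc, map_mem_walkLayer]

theorem mem_descSet {X : Set V} {w : V} : w ∈ D.descSet X ↔ ∃ x ∈ X, w ∈ D.desc x := by
  simp [descSet]

theorem descSet_closed (hacyc : D.NoDirectedCycles) {X : Set V} {v w : V}
    (hv : v ∈ D.descSet X) (h : D.Adj v w) : w ∈ D.descSet X := by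
  obtain ⟨x, hx, hvx⟩ := mem_descSet.1 hv
  exact mem_descSet.2 ⟨x, hx, desc_closed hacyc hvx (mem_desc_of_adj hacyc h)⟩

theorem map_mem_descSet_image (hacyc : D.NoDirectedCycles) (g : D.Aut) {X : Set V} {w : V} :
    g w ∈ D.descSet (g '' X) ↔ w ∈ D.descSet X := by
  simp [mem_descSet, map_mem_desc hacyc]

theorem descSet_union (X Y : Set V) : D.descSet (X ∪ Y) = D.descSet X ∪ D.descSet Y :=
  Set.biUnion_union X Y _

theorem descSet_singleton (x : V) : D.descSet {x} = D.desc x := by simp [descSet]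

theorem descSet_subset_desc (hacyc : D.NoDirectedCycles) {X : Set V} {v : V}
    (h : X ⊆ D.desc v) : D.descSet X ⊆ D.desc v := by
  intro w hw
  obtain ⟨x, hx, hwx⟩ := mem_descSet.1 hw
  exact desc_closed hacyc (h hx) hwx

theorem walkLayer_subset_desc (hacyc : D.NoDirectedCycles) (n : ℕ) (v : V) :
    D.walkLayer n v ⊆ D.desc v := fun _ h => (mem_desc_iff hacyc).2 ⟨n, h⟩

theorem finite_walkLayer {m : ℕ} (hout : D.HasOutValency m) (n : ℕ) (u : V) :
    (D.walkLayer n u).Finite := by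
  induction n with
  | zero => exact Set.finite_singleton u
  | succ n ih =>
    have : D.walkLayer (n + 1) u = ⋃ p ∈ D.walkLayer n u, D.outNeighbors p := by
      ext w
      simp [mem_walkLayer_succ, outNeighbors]
    rw [this]
    exact ih.biUnion fun p _ => Set.finite_of_encard_eq_coe (hout p)

theorem exists_adj {m : ℕ} (hm : 0 < m) (hout : D.HasOutValency m) (u : V) :
    ∃ w, D.Adj u w := by
  have : (D.outNeighbors u).encard ≠ 0 := by
    rw [hout u]
    exact_mod_cast hm.ne'
  exact Set.encard_ne_zero.1 this

theorem nonempty_walkLayer {m : ℕ} (hm : 0 < m) (hout : D.HasOutValency m) (n : ℕ) (u : V) :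
    (D.walkLayer n u).Nonempty := by
  induction n with
  | zero => exact ⟨u, rfl⟩
  | succ n ih =>
    obtain ⟨p, hp⟩ := ih
    obtain ⟨w, hw⟩ := exists_adj hm hout p
    exact ⟨w, p, hp, hw⟩

/-! ### Gluing automorphisms over disjoint descendant sets -/

/-- Two automorphisms, restricted to finite sets with disjoint descendant sets and sending them to
sets with disjoint descendant sets, have a common extension to an automorphism. -/
theorem IsWeaklyDescendantHomogeneous.exists_aut_glue (hwdh : D.IsWeaklyDescendantHomogeneous)
    (hacyc : D.NoDirectedCycles) {A B : Set V} (hA : A.Finite) (hB : B.Finite) (g₁ g₂ : D.Aut)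
    (hAB : Disjoint (D.descSet A) (D.descSet B))
    (hAB' : Disjoint (D.descSet (g₁ '' A)) (D.descSet (g₂ '' B))) :
    ∃ g : D.Aut, (∀ a ∈ A, g a = g₁ a) ∧ ∀ b ∈ B, g b = g₂ b := by
  classical
  have hmem : ∀ x : D.descSet (A ∪ B), x.1 ∈ D.descSet A ∨ x.1 ∈ D.descSet B := fun x => by
    simpa [descSet_union] using x.2
  have hB_notA : ∀ {x}, x ∈ D.descSet B → x ∉ D.descSet A := fun hx hx' =>
    Set.disjoint_left.1 hAB hx' hx
  let F : V → V := fun x => if x ∈ D.descSet A then g₁ x else g₂ x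
  have hFA : ∀ {x}, x ∈ D.descSet A → F x = g₁ x := fun hx => if_pos hx
  have hFB : ∀ {x}, x ∈ D.descSet B → F x = g₂ x := fun hx => if_neg (hB_notA hx)
  have hF : ∀ x : D.descSet (A ∪ B), F x ∈ D.descSet (g₁ '' A ∪ g₂ '' B) := by
    intro x
    rw [descSet_union]
    rcases hmem x with h | h
    · rw [hFA h]
      exact .inl ((map_mem_descSet_image hacyc g₁).2 h)
    · rw [hFB h]
      exact .inr ((map_mem_descSet_image hacyc g₂).2 h)
  have hsep : ∀ {x y}, x ∈ D.descSet A → y ∈ D.descSet B → g₁ x ∈ D.descSet (g₁ '' A) ∧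
      g₂ y ∈ D.descSet (g₂ '' B) := fun hx hy =>
    ⟨(map_mem_descSet_image hacyc g₁).2 hx, (map_mem_descSet_image hacyc g₂).2 hy⟩
  let φ : D.descSet (A ∪ B) → D.descSet (g₁ '' A ∪ g₂ '' B) := fun x => ⟨F x, hF x⟩
  have hφ : Function.Bijective φ := by
    constructor
    · intro x y hxy
      have hxy : F x = F y := congrArg Subtype.val hxy
      apply Subtype.ext
      rcases hmem x with hx | hx <;> rcases hmem y with hy | hy
      · rw [hFA hx, hFA hy] at hxy
        exact g₁.injective hxy
      · rw [hFA hx, hFB hy] at hxy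
        have := hsep hx hy
        rw [hxy] at this
        exact (Set.disjoint_left.1 hAB' this.1 this.2).elim
      · rw [hFB hx, hFA hy] at hxy
        have := hsep hy hx
        rw [hxy] at this
        exact (Set.disjoint_left.1 hAB' this.1 this.2).elim
      · rw [hFB hx, hFB hy] at hxy
        exact g₂.injective hxy
    · rintro ⟨y, hy⟩
      rw [descSet_union] at hy
      rcases hy with hy | hy
      · obtain ⟨x, rfl⟩ := g₁.surjective y
        have hx := (map_mem_descSet_image hacyc g₁).1 hy
        exact ⟨⟨x, by rw [descSet_union]; exact .inl hx⟩, Subtype.ext (hFA hx)⟩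
      · obtain ⟨x, rfl⟩ := g₂.surjective y
        have hx := (map_mem_descSet_image hacyc g₂).1 hy
        exact ⟨⟨x, by rw [descSet_union]; exact .inr hx⟩, Subtype.ext (hFB hx)⟩
  -- An edge between the two parts would put its head in both descendant sets, so there is none,
  -- before or after the map.
  have hadj : ∀ x y : D.descSet (A ∪ B), D.Adj (F x) (F y) ↔ D.Adj x.1 y.1 := by
    intro x y
    rcases hmem x with hx | hx <;> rcases hmem y with hy | hy
    · rw [hFA hx, hFA hy]
      exact g₁.map_rel_iff
    · rw [hFA hx, hFB hy]
      obtain ⟨h₁, h₂⟩ := hsep hx hy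
      exact ⟨fun h => (Set.disjoint_left.1 hAB' (descSet_closed hacyc h₁ h) h₂).elim,
        fun h => (Set.disjoint_left.1 hAB (descSet_closed hacyc hx h) hy).elim⟩
    · rw [hFB hx, hFA hy]
      obtain ⟨h₁, h₂⟩ := hsep hy hx
      exact ⟨fun h => (Set.disjoint_left.1 hAB' h₁ (descSet_closed hacyc h₂ h)).elim,
        fun h => (Set.disjoint_left.1 hAB hy (descSet_closed hacyc hx h)).elim⟩
    · rw [hFB hx, hFB hy]
      exact g₂.map_rel_iff
  obtain ⟨g, hg⟩ := hwdh.2 (A ∪ B) (g₁ '' A ∪ g₂ '' B) (hA.union hB)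
    ((hA.image _).union (hB.image _)) ⟨Equiv.ofBijective φ hφ, fun {x y} => hadj x y⟩
  refine ⟨g, fun a ha => ?_, fun b hb => ?_⟩
  · exact (hg a (.inl ha)).trans (hFA (D.mem_descSet_of_mem ha))
  · exact (hg b (.inr hb)).trans (hFB (D.mem_descSet_of_mem hb))

theorem IsWeaklyDescendantHomogeneous.exists_aut_of_disjoint
    (hwdh : D.IsWeaklyDescendantHomogeneous) (hacyc : D.NoDirectedCycles) {x y x' y' : V}
    (h : Disjoint (D.desc x) (D.desc y)) (h' : Disjoint (D.desc x') (D.desc y')) :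
    ∃ g : D.Aut, g x = x' ∧ g y = y' := by
  obtain ⟨g₁, rfl⟩ := hwdh.1 x x'
  obtain ⟨g₂, rfl⟩ := hwdh.1 y y'
  obtain ⟨g, h₁, h₂⟩ := hwdh.exists_aut_glue hacyc (Set.finite_singleton x)
    (Set.finite_singleton y) g₁ g₂ (by simpa [descSet_singleton] using h)
    (by simpa [descSet_singleton] using h')
  exact ⟨g, h₁ x rfl, h₂ y rfl⟩

/-! ### Disjointness of layers -/

/-- In a distance-transitive acyclic digraph of finite out-valency, distinct layers below a
vertex are disjoint. -/
theorem IsDistanceTransitive.eq_of_mem_walkLayer (hdist : D.IsDistanceTransitive)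
    (hacyc : D.NoDirectedCycles) {m : ℕ} (hout : D.HasOutValency m) {s t : ℕ} {u w : V}
    (hs : w ∈ D.walkLayer s u) (ht : w ∈ D.walkLayer t u) : s = t := by
  classical
  by_contra hne
  have hex : ∃ s t u w, s < t ∧ w ∈ D.walkLayer s u ∧ w ∈ D.walkLayer t u := by
    rcases lt_or_gt_of_ne hne with h | h
    · exact ⟨s, t, u, w, h, hs, ht⟩
    · exact ⟨t, s, u, w, h, ht, hs⟩
  -- Minimality of the smaller depth `s` makes every vertex of an `s`-th layer a vertex at directed
  -- distance `s`, so that distance-transitivity applies.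
  obtain ⟨t, u, w, hst, hs, ht⟩ := Nat.find_spec hex
  have hmin : ∀ {s'}, s' < Nat.find hex → ∀ t u w, s' < t → w ∈ D.walkLayer s' u →
      w ∉ D.walkLayer t u := fun hs' t u w h h₁ h₂ =>
    Nat.find_min hex hs' ⟨t, u, w, h, h₁, h₂⟩
  generalize Nat.find hex = s at *
  have hat : ∀ u w, w ∈ D.walkLayer s u → D.AtDistance s u w := fun u w h =>
    ⟨by rwa [layer_eq_walkLayer hacyc], fun s' hs' h' =>
      hmin hs' s u w hs' (by rwa [layer_eq_walkLayer hacyc] at h') h⟩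
  have hsub : ∀ w' ∈ D.walkLayer s u, w' ∈ D.walkLayer t u := fun w' hw' => by
    obtain ⟨g, hgu, hgw⟩ := hdist s u w u w' (hat _ _ hs) (hat _ _ hw')
    rw [← hgw, ← hgu, map_mem_walkLayer]
    exact ht
  have : IsStrictOrder V (Relation.TransGen D.Adj) :=
    { irrefl := hacyc, trans := fun _ _ _ => Relation.TransGen.trans }
  have hwf := (finite_walkLayer hout s u).wellFoundedOn (r := Relation.TransGen D.Adj)
  -- Infinite descent: layer `s` lies in layer `t > s`, so each of its vertices has a proper
  -- ancestor in layer `s`, which is finite.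
  refine hwf.induction (P := fun _ => False) hs fun y hy ih => ?_
  obtain ⟨d, rfl⟩ := Nat.exists_eq_add_of_lt hst
  obtain ⟨p, hp, hpy⟩ := mem_walkLayer_add.1 (add_assoc s d 1 ▸ hsub y hy)
  exact ih p hp (transGen_of_mem_walkLayer hpy)

theorem IsDistanceTransitive.exists_aut_of_mem_walkLayer (hdist : D.IsDistanceTransitive)
    (hacyc : D.NoDirectedCycles) {m : ℕ} (hout : D.HasOutValency m) {s : ℕ} {u w u' w' : V}
    (h : w ∈ D.walkLayer s u) (h' : w' ∈ D.walkLayer s u') :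
    ∃ g : D.Aut, g u = u' ∧ g w = w' := by
  have hat : ∀ u w, w ∈ D.walkLayer s u → D.AtDistance s u w := fun u w h =>
    ⟨by rwa [layer_eq_walkLayer hacyc], fun t ht h' => ht.ne
      (hdist.eq_of_mem_walkLayer hacyc hout (by rwa [layer_eq_walkLayer hacyc] at h') h)⟩
  exact hdist s u w u' w' (hat _ _ h) (hat _ _ h')

theorem image_walkLayer_descSubdigraph (hacyc : D.NoDirectedCycles) (α : V) (n : ℕ) :
    Subtype.val '' (D.descSubdigraph α).walkLayer n (D.descRoot α) = D.walkLayer n α := by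
  induction n with
  | zero => simp [walkLayer, descRoot]
  | succ n ih =>
    ext w
    constructor
    · rintro ⟨w, ⟨p, hp, hpw⟩, rfl⟩
      exact ⟨p, ih ▸ ⟨p, hp, rfl⟩, hpw⟩
    · rintro ⟨p, hp, hpw⟩
      rw [← ih] at hp
      obtain ⟨p, hp, rfl⟩ := hp
      exact ⟨⟨w, desc_closed hacyc p.2 (mem_desc_of_adj hacyc hpw)⟩, ⟨p, hp, hpw⟩, rfl⟩

theorem ncard_walkLayer_lt (hacyc : D.NoDirectedCycles) (hvt : D.IsVertexTransitive) {m : ℕ}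
    (hout : D.HasOutValency m) {α : V} (hP3 : (D.descSubdigraph α).P3 (D.descRoot α))
    (n : ℕ) (u : V) : (D.walkLayer n u).ncard < (D.walkLayer (n + 1) u).ncard := by
  have hacyc' : (D.descSubdigraph α).NoDirectedCycles := fun v hv =>
    hacyc v.1 (Relation.TransGen.lift (p := D.Adj) Subtype.val (fun _ _ h => h) v v hv)
  have key : (D.walkLayer n α).encard < (D.walkLayer (n + 1) α).encard := by
    have := hP3 n
    rw [layer_eq_walkLayer hacyc', layer_eq_walkLayer hacyc',
      ← Subtype.val_injective.encard_image, ← Subtype.val_injective.encard_image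
        (D.descSubdigraph α |>.walkLayer (n + 1) _)] at this
    rwa [image_walkLayer_descSubdigraph hacyc, image_walkLayer_descSubdigraph hacyc] at this
  obtain ⟨g, rfl⟩ := hvt α u
  rw [← image_walkLayer, ← image_walkLayer, Set.ncard_image_of_injective _ g.injective,
    Set.ncard_image_of_injective _ g.injective]
  rw [← (finite_walkLayer hout n α).cast_ncard_eq,
    ← (finite_walkLayer hout (n + 1) α).cast_ncard_eq] at key
  exact_mod_cast key

theorem ncard_walkLayer_eq (hvt : D.IsVertexTransitive) (n : ℕ) (u v : V) :
    (D.walkLayer n u).ncard = (D.walkLayer n v).ncard := by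
  obtain ⟨g, rfl⟩ := hvt u v
  rw [← image_walkLayer, Set.ncard_image_of_injective _ g.injective]

/-! ### Stabilisation of the number of parents -/

/-- The in-neighbours of `w` in the `n`-th layer below `u`. -/
def layerInNeighbors (D : Digraph V) (n : ℕ) (u w : V) : Set V :=
  {p ∈ D.walkLayer n u | D.Adj p w}

theorem finite_layerInNeighbors {m : ℕ} (hout : D.HasOutValency m) (n : ℕ) (u w : V) :
    (D.layerInNeighbors n u w).Finite :=
  (finite_walkLayer hout n u).subset fun _ h => h.1

theorem layerInNeighbors_subset_succ {n : ℕ} {u x w : V} (hx : D.Adj u x) :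
    D.layerInNeighbors n x w ⊆ D.layerInNeighbors (n + 1) u w :=
  fun _ hp => ⟨mem_walkLayer_succ_of_adj hx hp.1, hp.2⟩

theorem image_layerInNeighbors (g : D.Aut) (n : ℕ) (u w : V) :
    g '' D.layerInNeighbors n u w = D.layerInNeighbors n (g u) (g w) := by
  ext p
  obtain ⟨p, rfl⟩ := g.surjective p
  simp [layerInNeighbors, map_mem_walkLayer, g.map_rel_iff]

theorem IsDistanceTransitive.ncard_layerInNeighbors_eq (hdist : D.IsDistanceTransitive)
    (hacyc : D.NoDirectedCycles) {m : ℕ} (hout : D.HasOutValency m) {n : ℕ} {u w u' w' : V}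
    (h : w ∈ D.walkLayer (n + 1) u) (h' : w' ∈ D.walkLayer (n + 1) u') :
    (D.layerInNeighbors n u w).ncard = (D.layerInNeighbors n u' w').ncard := by
  obtain ⟨g, rfl, rfl⟩ := hdist.exists_aut_of_mem_walkLayer hacyc hout h h'
  rw [← image_layerInNeighbors, Set.ncard_image_of_injective _ g.injective]

/-- Double counting of the edges between layers `n` and `n + 1`: all vertices of the larger layer
have equally many parents, and those of the smaller one have at most `m` children there. -/
theorem IsDistanceTransitive.ncard_layerInNeighbors_le (hdist : D.IsDistanceTransitive)
    (hacyc : D.NoDirectedCycles) {m : ℕ} (hout : D.HasOutValency m) {n : ℕ} {u w : V}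
    (hlt : (D.walkLayer n u).ncard < (D.walkLayer (n + 1) u).ncard)
    (h : w ∈ D.walkLayer (n + 1) u) : (D.layerInNeighbors n u w).ncard ≤ m := by
  classical
  have hf := finite_walkLayer hout n u
  have hf' := finite_walkLayer hout (n + 1) u
  have key := Finset.card_mul_le_card_mul (s := hf'.toFinset) (t := hf.toFinset)
    (m := (D.layerInNeighbors n u w).ncard) (n := m) (fun w p => D.Adj p w) ?_ ?_
  · rw [← Set.ncard_eq_toFinset_card _ hf, ← Set.ncard_eq_toFinset_card _ hf'] at key
    by_contra! hm
    have h0 : 0 < (D.walkLayer (n + 1) u).ncard := by omega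
    nlinarith [Nat.mul_le_mul hlt.le (le_refl m), Nat.mul_lt_mul_of_pos_left hm h0]
  · intro w' hw'
    rw [hdist.ncard_layerInNeighbors_eq hacyc hout h (by simpa using hw'),
      ← Set.ncard_coe_finset]
    refine Set.ncard_le_ncard (fun p hp => ?_) (Finset.finite_toSet _)
    simpa [Finset.bipartiteAbove, layerInNeighbors] using hp
  · intro p _
    have hp : (D.outNeighbors p).ncard = m := by
      rw [Set.ncard, hout p, ENat.toNat_natCast]
    rw [← hp, ← Set.ncard_coe_finset]
    refine Set.ncard_le_ncard (fun q hq => ?_) (Set.finite_of_encard_eq_coe (hout p))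
    simp only [Finset.bipartiteBelow, Finset.coe_filter, Set.mem_ofPred_eq] at hq
    exact hq.2

/-- Sufficiently deep below a child `x` of `u`, all parents within the descendant set of `u`
lie in the descendant set of `x`. -/
theorem IsDistanceTransitive.exists_parents_mem_walkLayer (hdist : D.IsDistanceTransitive)
    (hacyc : D.NoDirectedCycles) {m : ℕ} (hm : 0 < m) (hout : D.HasOutValency m) [Nonempty V]
    (hlt : ∀ n u, (D.walkLayer n u).ncard < (D.walkLayer (n + 1) u).ncard) :
    ∃ k, ∀ t ≥ k, ∀ u x w p, D.Adj u x → w ∈ D.walkLayer (t + 1) x →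
      p ∈ D.walkLayer (t + 1) u → D.Adj p w → p ∈ D.walkLayer t x := by
  obtain ⟨a⟩ := ‹Nonempty V›
  choose c hc using fun n => nonempty_walkLayer hm hout (n + 1) a
  let r : ℕ → ℕ := fun n => (D.layerInNeighbors n a (c n)).ncard
  have hr : ∀ {n u w}, w ∈ D.walkLayer (n + 1) u → (D.layerInNeighbors n u w).ncard = r n :=
    fun h => hdist.ncard_layerInNeighbors_eq hacyc hout h (hc _)
  have hrm : ∀ n, r n ≤ m := fun n =>
    hdist.ncard_layerInNeighbors_le hacyc hout (hlt n a) (hc n)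
  have hmono : Monotone r := monotone_nat_of_le_succ fun n => by
    obtain ⟨x, hx, hcx⟩ := mem_walkLayer_succ_iff.1 (hc (n + 1))
    rw [← hr hcx]
    exact Set.ncard_le_ncard (layerInNeighbors_subset_succ hx)
      (finite_layerInNeighbors hout _ _ _)
  -- `r` is monotone and bounded by `m`; it stays constant once `m - r n` is minimal.
  let k := Function.argmin fun n => m - r n
  have hk : ∀ t ≥ k, r t = r k := fun t ht => by
    have h₁ : m - r k ≤ m - r t := Function.argmin_le (fun n => m - r n) t
    have h₂ := hmono ht
    have h₃ := hrm t
    have h₄ := hrm k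
    omega
  refine ⟨k, fun t ht u x w p hx hw hp hpw => ?_⟩
  have heq := Set.eq_of_subset_of_ncard_le (layerInNeighbors_subset_succ (w := w) hx)
    (by rw [hr (mem_walkLayer_succ_of_adj hx hw), hr hw, hk t ht, hk (t + 1) (by omega)])
    (finite_layerInNeighbors hout (t + 1) u w)
  exact (heq.symm ▸ (⟨hp, hpw⟩ : p ∈ D.layerInNeighbors (t + 1) u w) :
    p ∈ D.layerInNeighbors t x w).1

/-! ### Separated siblings -/

/-- Two vertices are separated at depth `j` if every vertex of the `j`-th layer below one of them
which is not in the `j`-th layer below the other has no common descendant with the other. -/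
def SeparatedAt (D : Digraph V) (j : ℕ) (x y : V) : Prop :=
  (∀ d ∈ D.walkLayer j y, d ∉ D.walkLayer j x → Disjoint (D.desc d) (D.desc x)) ∧
    ∀ d ∈ D.walkLayer j x, d ∉ D.walkLayer j y → Disjoint (D.desc d) (D.desc y)

/-- From a common descendant, climb a walk back to `d`: each parent on it stays below `x` at the
matching depth, until `d` itself would lie in the `k`-th layer of `x`. -/
theorem disjoint_desc_of_notMem (hacyc : D.NoDirectedCycles)
    (hlayer : ∀ {s t u w}, w ∈ D.walkLayer s u → w ∈ D.walkLayer t u → s = t) {k : ℕ}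
    (hk : ∀ t ≥ k, ∀ u x w p, D.Adj u x → w ∈ D.walkLayer (t + 1) x →
      p ∈ D.walkLayer (t + 1) u → D.Adj p w → p ∈ D.walkLayer t x)
    {u x y d : V} (hx : D.Adj u x) (hy : D.Adj u y) (hd : d ∈ D.walkLayer k y)
    (hdx : d ∉ D.walkLayer k x) : Disjoint (D.desc d) (D.desc x) := by
  rw [Set.disjoint_left]
  intro w hwd hwx
  obtain ⟨a, ha⟩ := (mem_desc_iff hacyc).1 hwd
  obtain ⟨b, hb⟩ := (mem_desc_iff hacyc).1 hwx
  -- Both numbers are one less than the depth of `w` below `u`, which is unique.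
  obtain rfl : k + a = b := Nat.succ_injective (hlayer
    (mem_walkLayer_succ_of_adj hy (mem_walkLayer_add_of_mem hd ha))
    (mem_walkLayer_succ_of_adj hx hb))
  clear hwd hwx
  induction a generalizing w with
  | zero =>
    obtain rfl := mem_walkLayer_zero.1 ha
    exact hdx hb
  | succ a ih =>
    obtain ⟨p, hp, hpw⟩ := ha
    exact ih hp (hk (k + a) (by omega) u x w p hx hb
      (mem_walkLayer_succ_of_adj hy (mem_walkLayer_add_of_mem hd hp)) hpw)

theorem exists_separatedAt (hacyc : D.NoDirectedCycles) (hdist : D.IsDistanceTransitive)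
    {m : ℕ} (hm : 0 < m) (hout : D.HasOutValency m) (hvt : D.IsVertexTransitive)
    (hlt : ∀ n u, (D.walkLayer n u).ncard < (D.walkLayer (n + 1) u).ncard) (u : V) :
    ∃ k x y, D.Adj u x ∧ D.Adj u y ∧ D.SeparatedAt k x y ∧
      ∃ d ∈ D.walkLayer k y, d ∉ D.walkLayer k x := by
  have : Nonempty V := ⟨u⟩
  obtain ⟨k, hk⟩ := hdist.exists_parents_mem_walkLayer hacyc hm hout hlt
  obtain ⟨x, hx⟩ := exists_adj hm hout u
  have hlayer : ∀ {s t u w}, w ∈ D.walkLayer s u → w ∈ D.walkLayer t u → s = t :=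
    fun h h' => hdist.eq_of_mem_walkLayer hacyc hout h h'
  obtain ⟨d, hd, hdx⟩ : ∃ d ∈ D.walkLayer (k + 1) u, d ∉ D.walkLayer k x := by
    by_contra! hsub
    have := Set.ncard_le_ncard hsub (finite_walkLayer hout k x)
    rw [ncard_walkLayer_eq hvt k x u] at this
    exact absurd (hlt k u) this.not_gt
  obtain ⟨y, hy, hdy⟩ := mem_walkLayer_succ_iff.1 hd
  exact ⟨k, x, y, hx, hy, ⟨fun e he he' => disjoint_desc_of_notMem hacyc hlayer hk hx hy he he',
    fun e he he' => disjoint_desc_of_notMem hacyc hlayer hk hy hx he he'⟩, d, hdy, hdx⟩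

/-! ### Property Z and in-valency -/

/-- By connectedness an automorphism shifts the height `f` by a constant. One that fixes `x` and
moves `z` to its child `z'` would have shift both 0 and 1. -/
theorem IsWeaklyDescendantHomogeneous.not_hasPropertyZ (hwdh : D.IsWeaklyDescendantHomogeneous)
    (hacyc : D.NoDirectedCycles) (hconn : D.IsConnected) {x z z' : V} (hz : D.Adj z z')
    (h : Disjoint (D.desc x) (D.desc z)) : ¬ D.HasPropertyZ := by
  rintro ⟨f, -⟩
  obtain ⟨g, hgx, hgz⟩ := hwdh.exists_aut_of_disjoint hacyc h
    (h.mono_right (desc_subset_desc hacyc (mem_desc_of_adj hacyc hz)))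
  have hf : ∀ {u v}, D.Adj u v → f v = f u + 1 := fun h => f.map_rel h
  have key : ∀ v, f (g v) - f v = f (g x) - f x := by
    intro v
    obtain ⟨p⟩ := hconn.preconnected v x
    induction p with
    | nil => rfl
    | cons hadj p ih =>
      rw [← ih h hgx]
      rcases (SimpleGraph.fromRel_adj _ _ _).1 hadj with ⟨-, h | h⟩ <;>
      · have h₁ := hf h
        have h₂ := hf (g.map_rel_iff.2 h)
        omega
  have h₁ := key z
  rw [hgx, hgz, hf hz] at h₁
  omega

/-- The ball of radius `n` around a vertex in the underlying undirected graph. -/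
def undirectedBall (D : Digraph V) : ℕ → V → Set V
  | 0, v => {v}
  | n + 1, v => ⋃ p ∈ D.undirectedBall n v, D.outNeighbors p ∪ D.inNeighbors p

theorem map_mem_undirectedBall (g : D.Aut) {n : ℕ} {u w : V} :
    g w ∈ D.undirectedBall n (g u) ↔ w ∈ D.undirectedBall n u := by
  induction n generalizing w with
  | zero => simp [undirectedBall]
  | succ n ih =>
    simp only [undirectedBall, Set.mem_iUnion, exists_prop]
    rw [g.surjective.exists]
    simp [ih, outNeighbors, inNeighbors, g.map_rel_iff]

theorem exists_mem_undirectedBall (hconn : D.IsConnected) (u w : V) :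
    ∃ n, w ∈ D.undirectedBall n u := by
  obtain ⟨p⟩ := hconn.preconnected w u
  induction p with
  | nil => exact ⟨0, rfl⟩
  | cons hadj p ih =>
    obtain ⟨n, hn⟩ := ih
    refine ⟨n + 1, Set.mem_biUnion hn ?_⟩
    exact ((SimpleGraph.fromRel_adj _ _ _).1 hadj).2.symm

theorem finite_undirectedBall (hout : ∀ v, (D.outNeighbors v).Finite)
    (hin : ∀ v, (D.inNeighbors v).Finite) (n : ℕ) (u : V) : (D.undirectedBall n u).Finite := by
  induction n with
  | zero => exact Set.finite_singleton u
  | succ n ih => exact ih.biUnion fun p _ => (hout p).union (hin p)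

theorem infinite_desc (hacyc : D.NoDirectedCycles) (hdist : D.IsDistanceTransitive)
    {m : ℕ} (hm : 0 < m) (hout : D.HasOutValency m) (u : V) : (D.desc u).Infinite := by
  choose c hc using fun n => nonempty_walkLayer hm hout n u
  refine Set.infinite_of_injective_forall_mem (f := c) (fun i j hij => ?_)
    fun n => walkLayer_subset_desc hacyc n u (hc n)
  exact hdist.eq_of_mem_walkLayer hacyc hout (hc i) (hij ▸ hc j)

/-- The stabiliser of `x` moves `z` to each of its infinitely many descendants, so all of them lie
in one undirected ball around `x`; finite in-valency would make this ball finite. -/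
theorem IsWeaklyDescendantHomogeneous.hasInfiniteInValency
    (hwdh : D.IsWeaklyDescendantHomogeneous) (hacyc : D.NoDirectedCycles)
    (hdist : D.IsDistanceTransitive) (hconn : D.IsConnected) {m : ℕ} (hm : 0 < m)
    (hout : D.HasOutValency m) {x z : V} (h : Disjoint (D.desc x) (D.desc z)) :
    D.HasInfiniteInValency := by
  intro v hv
  have hin : ∀ v, (D.inNeighbors v).Finite := fun w => by
    obtain ⟨g, rfl⟩ := hwdh.1 v w
    refine (hv.image g).subset fun p hp => ?_
    obtain ⟨p, rfl⟩ := g.surjective p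
    exact ⟨p, g.map_rel_iff.1 hp, rfl⟩
  obtain ⟨n, hn⟩ := exists_mem_undirectedBall hconn x z
  refine infinite_desc hacyc hdist hm hout z
    ((finite_undirectedBall (fun v => Set.finite_of_encard_eq_coe (hout v)) hin n x).subset
      fun w hw => ?_)
  obtain ⟨g, hgx, rfl⟩ := hwdh.exists_aut_of_disjoint hacyc h
    (h.mono_right (desc_subset_desc hacyc hw))
  rw [← hgx]
  exact (map_mem_undirectedBall g).2 hn

/-! ### Reachability as an equivalence of edges -/

/-- Two edges, given as pairs of vertices, share their tail or share their head. -/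
def EdgeIncident (D : Digraph V) (e f : V × V) : Prop :=
  D.Adj e.1 e.2 ∧ D.Adj f.1 f.2 ∧ (e.1 = f.1 ∨ e.2 = f.2)

/-- The equivalence relation on edges generated by sharing a tail or a head. -/
def EdgeEquiv (D : Digraph V) : V × V → V × V → Prop := Relation.ReflTransGen D.EdgeIncident

theorem EdgeEquiv.symm {e f : V × V} (h : D.EdgeEquiv e f) : D.EdgeEquiv f e := by
  have : Std.Symm D.EdgeIncident :=
    ⟨fun _ _ h => ⟨h.2.1, h.1, h.2.2.imp Eq.symm Eq.symm⟩⟩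
  exact Relation.ReflTransGen.stdSymm.symm _ _ h

theorem EdgeEquiv.trans {e f e' : V × V} (h : D.EdgeEquiv e f) (h' : D.EdgeEquiv f e') :
    D.EdgeEquiv e e' := Relation.ReflTransGen.trans h h'

theorem EdgeEquiv.of_head {a b c : V} (h : D.Adj a c) (h' : D.Adj b c) :
    D.EdgeEquiv (a, c) (b, c) := .single ⟨h, h', .inr rfl⟩

theorem EdgeEquiv.of_tail {a b c : V} (h : D.Adj a b) (h' : D.Adj a c) :
    D.EdgeEquiv (a, b) (a, c) := .single ⟨h, h', .inl rfl⟩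

theorem EdgeEquiv.map (g : D.Aut) {e f : V × V} (h : D.EdgeEquiv e f) :
    D.EdgeEquiv (g e.1, g e.2) (g f.1, g f.2) :=
  Relation.ReflTransGen.lift (p := D.EdgeIncident) (fun e : V × V => (g e.1, g e.2))
    (fun _ _ h => ⟨g.map_rel_iff.2 h.1, g.map_rel_iff.2 h.2.1,
      h.2.2.imp (congrArg g) (congrArg g)⟩) _ _ h

/-- The alternating walk `x 0, …, x (n + 1)` begins with the edge `(a, b)`, traversed forwards, and
its last two vertices are `p` and `q`, in this order. -/
def AltWalkTo (D : Digraph V) (a b : V) (n : ℕ) (p q : V) : Prop :=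
  ∃ x : ℕ → V, (∀ i, i < n + 1 →
    (Even i → D.Adj (x i) (x (i + 1))) ∧ (Odd i → D.Adj (x (i + 1)) (x i))) ∧
    a = x 0 ∧ b = x 1 ∧ p = x n ∧ q = x (n + 1)

theorem AltWalkTo.extend {a b : V} {n : ℕ} {p q w : V} (h : D.AltWalkTo a b n p q)
    (hw : (Even n → D.Adj w q) ∧ (Odd n → D.Adj q w)) : D.AltWalkTo a b (n + 1) q w := by
  obtain ⟨x, hx, rfl, rfl, rfl, rfl⟩ := h
  refine ⟨fun i => if i ≤ n + 1 then x i else w, fun i hi => ?_, by simp, by simp, by simp,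
    by simp⟩
  rcases Nat.lt_succ_iff_lt_or_eq.1 hi with h | rfl
  · simpa [h.le, show i ≤ n by omega] using hx i h
  · simpa [Nat.even_add_one, Nat.odd_add_one] using And.symm hw

/-- The parity of `n` records whether the last edge is traversed forwards. If the next edge shares
the endpoint just left, the walk first retraces its last edge, which costs two steps instead of one.
-/
theorem EdgeEquiv.reachable {e f : V × V} (he : D.Adj e.1 e.2) (h : D.EdgeEquiv e f) :
    D.Reachable e.1 e.2 f.1 f.2 := by
  have key : ∃ n, (Even n ∧ D.AltWalkTo e.1 e.2 n f.1 f.2) ∨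
      (Odd n ∧ D.AltWalkTo e.1 e.2 n f.2 f.1) := by
    induction h with
    | refl =>
      refine ⟨0, .inl ⟨Even.zero, fun i => if i = 0 then e.1 else e.2, fun i hi => ?_,
        rfl, rfl, rfl, rfl⟩⟩
      obtain rfl : i = 0 := by omega
      simpa using he
    | @tail f f' _ hff' ih =>
      obtain ⟨n, ⟨hn, hw⟩ | ⟨hn, hw⟩⟩ := ih
      · have hn' : ¬ Odd n := Nat.not_odd_iff_even.2 hn
        obtain ⟨h₁, h₂, h | h⟩ := hff'
        · have hw' := hw.extend (w := f.1) ⟨fun _ => h₁, fun h => absurd h hn'⟩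
          refine ⟨n + 2, .inl ⟨hn.add even_two, ?_⟩⟩
          rw [← h] at h₂ ⊢
          exact hw'.extend ⟨fun h => absurd hn (Nat.even_add_one.1 h), fun _ => h₂⟩
        · rw [← h] at h₂ ⊢
          exact ⟨n + 1, .inr ⟨hn.add_one, hw.extend ⟨fun _ => h₂, fun h => absurd h hn'⟩⟩⟩
      · have hn' : ¬ Even n := Nat.not_even_iff_odd.2 hn
        obtain ⟨h₁, h₂, h | h⟩ := hff'
        · rw [← h] at h₂ ⊢
          exact ⟨n + 1, .inl ⟨hn.add_one, hw.extend ⟨fun h => absurd h hn', fun _ => h₂⟩⟩⟩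
        · have hw' := hw.extend (w := f.2) ⟨fun h => absurd h hn', fun _ => h₁⟩
          refine ⟨n + 2, .inr ⟨hn.add_even even_two, ?_⟩⟩
          rw [← h] at h₂ ⊢
          exact hw'.extend ⟨fun _ => h₂, fun h => absurd hn (Nat.odd_add_one.1 h)⟩
  obtain ⟨n, ⟨-, x, hx, h0, h1, h2, h3⟩ | ⟨-, x, hx, h0, h1, h2, h3⟩⟩ := key
  · exact ⟨n, x, .inl hx, h0, h1, .inl ⟨h2, h3⟩⟩
  · exact ⟨n, x, .inl hx, h0, h1, .inr ⟨h3, h2⟩⟩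

/-- All edges at a vertex are equivalent: in-edges share a head, out-edges a tail, and the
hypothesis links both kinds. Connectedness spreads this. -/
theorem reachabilityIsUniversal_of_edgeEquiv (hconn : D.IsConnected)
    (h : ∀ a b c, D.Adj a b → D.Adj b c → D.EdgeEquiv (a, b) (b, c)) :
    D.ReachabilityIsUniversal := by
  intro a b c d hab hcd
  refine EdgeEquiv.reachable (e := (a, b)) (f := (c, d)) hab ?_
  have key : ∀ v p q, D.Adj p q → (p = v ∨ q = v) → D.EdgeEquiv (a, b) (p, q) := by
    intro v
    obtain ⟨w⟩ := hconn.preconnected v b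
    induction w with
    | nil =>
      rintro p q hpq (rfl | rfl)
      · exact h _ _ _ hab hpq
      · exact .of_head hab hpq
    | @cons v w b hadj _ ih =>
      rintro p q hpq hv
      rcases (SimpleGraph.fromRel_adj _ _ _).1 hadj with ⟨-, hvw | hwv⟩
      · refine (ih hab v w hvw (.inr rfl)).trans ?_
        rcases hv with rfl | rfl
        · exact .of_tail hvw hpq
        · exact (h _ _ _ hpq hvw).symm
      · refine (ih hab w v hwv (.inl rfl)).trans ?_
        rcases hv with rfl | rfl
        · exact h _ _ _ hwv hpq
        · exact .of_head hwv hpq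
  exact key c c d hcd (.inl rfl)

/-! ### Universality from equivalent heads with disjoint descendants -/

/-- Two vertices are the heads of equivalent edges. -/
def SameIn (D : Digraph V) (x y : V) : Prop :=
  ∃ a b, D.Adj a x ∧ D.Adj b y ∧ D.EdgeEquiv (a, x) (b, y)

theorem SameIn.symm {x y : V} : D.SameIn x y → D.SameIn y x :=
  fun ⟨a, b, ha, hb, h⟩ => ⟨b, a, hb, ha, h.symm⟩

theorem SameIn.trans {x y z : V} : D.SameIn x y → D.SameIn y z → D.SameIn x z :=
  fun ⟨a, _, ha, hb, h⟩ ⟨_, d, hc, hd, h'⟩ =>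
    ⟨a, d, ha, hd, (h.trans (.of_head hb hc)).trans h'⟩

theorem SameIn.map (g : D.Aut) {x y : V} : D.SameIn x y → D.SameIn (g x) (g y) :=
  fun ⟨a, b, ha, hb, h⟩ => ⟨g a, g b, g.map_rel_iff.2 ha, g.map_rel_iff.2 hb, h.map g⟩

/-- Fixing `x` and moving `y` to a child `z` gives `SameIn y z`, so edges into `y` are equivalent to
`(y, z)`. Transitivity on edges carries this to every 2-arc. -/
theorem IsWeaklyDescendantHomogeneous.reachabilityIsUniversal
    (hwdh : D.IsWeaklyDescendantHomogeneous) (hacyc : D.NoDirectedCycles)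
    (hdist : D.IsDistanceTransitive) (hconn : D.IsConnected) {m : ℕ} (hm : 0 < m)
    (hout : D.HasOutValency m) {x y : V} (h : Disjoint (D.desc x) (D.desc y))
    (hxy : D.SameIn x y) : D.ReachabilityIsUniversal := by
  obtain ⟨z, hz⟩ := exists_adj hm hout y
  obtain ⟨g, hgx, hgy⟩ := hwdh.exists_aut_of_disjoint hacyc h
    (h.mono_right (desc_subset_desc hacyc (mem_desc_of_adj hacyc hz)))
  have hxz : D.SameIn x z := by
    have := hxy.map g
    rwa [hgx, hgy] at this
  obtain ⟨a, b, ha, hb, hab⟩ := hxy.symm.trans hxz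
  have hyz : D.EdgeEquiv (a, y) (y, z) := hab.trans (.of_head hb hz)
  refine reachabilityIsUniversal_of_edgeEquiv hconn fun p q r hpq hqr => ?_
  obtain ⟨g, rfl, rfl⟩ := hdist.exists_aut_of_mem_walkLayer hacyc hout
    (mem_walkLayer_one.2 hz) (mem_walkLayer_one.2 hqr)
  exact (EdgeEquiv.of_head hpq (g.map_rel_iff.2 ha)).trans (hyz.map g)

/-- Continue `j` steps below `z`: the resulting walk from `u` has length at least `j`, so it crosses
the `j`-th layer. -/
theorem exists_mem_walkLayer_of_mem_desc (hacyc : D.NoDirectedCycles) {m : ℕ} (hm : 0 < m)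
    (hout : D.HasOutValency m) {u z : V} (hz : z ∈ D.desc u) (j : ℕ) :
    ∃ q ∈ D.walkLayer j u, ∃ w ∈ D.desc q, w ∈ D.desc z := by
  obtain ⟨n, hn⟩ := (mem_desc_iff hacyc).1 hz
  obtain ⟨w, hw⟩ := nonempty_walkLayer hm hout j z
  have h := mem_walkLayer_add_of_mem hn hw
  rw [add_comm] at h
  obtain ⟨q, hq, hwq⟩ := mem_walkLayer_add.1 h
  exact ⟨q, hq, w, walkLayer_subset_desc hacyc _ _ hwq, walkLayer_subset_desc hacyc _ _ hw⟩

theorem SeparatedAt.disjoint_desc (hacyc : D.NoDirectedCycles) {m : ℕ} (hm : 0 < m)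
    (hout : D.HasOutValency m) {j : ℕ} {x y : V} (hsep : D.SeparatedAt j x y)
    (h : Disjoint (D.walkLayer j x) (D.walkLayer j y)) : Disjoint (D.desc x) (D.desc y) := by
  refine Set.disjoint_left.2 fun z hzx hzy => ?_
  obtain ⟨q, hq, w, hwq, hwz⟩ := exists_mem_walkLayer_of_mem_desc hacyc hm hout hzy j
  exact Set.disjoint_left.1 (hsep.1 q hq fun hqx => Set.disjoint_left.1 h hqx hq) hwq
    (desc_closed hacyc hzx hwz)

/-! ### Shrinking the overlap -/

/-- If the separated pair `v`, `c` of `SameIn` vertices overlaps at depth `j`, but not completely,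
then there is such a pair with a smaller overlap. -/
theorem IsWeaklyDescendantHomogeneous.exists_separatedAt_ncard_lt
    (hwdh : D.IsWeaklyDescendantHomogeneous) (hacyc : D.NoDirectedCycles)
    (hdist : D.IsDistanceTransitive) {m : ℕ} (hm : 0 < m) (hout : D.HasOutValency m) {e₀ e₁ e₂ : V}
    (h₀₁ : Disjoint (D.desc e₀) (D.desc e₁)) (h₀₂ : Disjoint (D.desc e₀) (D.desc e₂))
    (h₁₂ : Disjoint (D.desc e₁) (D.desc e₂)) {j : ℕ} {v c p d : V} (hvc : D.SameIn v c)
    (hsep : D.SeparatedAt j v c) (hpv : p ∈ D.walkLayer j v) (hpc : p ∈ D.walkLayer j c)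
    (hdv : d ∈ D.walkLayer j v) (hdc : d ∉ D.walkLayer j c) :
    ∃ v' c', D.SameIn v' c' ∧ D.SeparatedAt j v' c' ∧
      (D.walkLayer j v' ∩ D.walkLayer j c').ncard <
        (D.walkLayer j v ∩ D.walkLayer j c).ncard := by
  -- By separation, the part of the layer of `c` outside that of `v` has descendants disjoint from
  -- `desc v`. It can be thrown into `desc e₁` while `v` and its layer follow `φ`.
  have hglue : ∀ (φ : D.Aut) (e₁ : V), Disjoint (D.desc (φ v)) (D.desc e₁) →
      ∃ g : D.Aut, g v = φ v ∧ (∀ w ∈ D.walkLayer j v, g w = φ w) ∧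
        ∀ w ∈ D.walkLayer j c, w ∉ D.walkLayer j v → g w ∈ D.desc e₁ := by
    intro φ e₁ he
    obtain ⟨τ, rfl⟩ := hwdh.1 c e₁
    have hBc : τ '' (D.walkLayer j c \ D.walkLayer j v) ⊆ D.desc (τ c) := by
      rintro _ ⟨w, hw, rfl⟩
      exact (map_mem_desc hacyc τ).2 (walkLayer_subset_desc hacyc _ _ hw.1)
    have hAv : insert v (D.walkLayer j v) ⊆ D.desc v :=
      Set.insert_subset (D.mem_desc_self v) (walkLayer_subset_desc hacyc _ _)
    have hAφ : φ '' insert v (D.walkLayer j v) ⊆ D.desc (φ v) := by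
      rintro _ ⟨w, hw, rfl⟩
      exact (map_mem_desc hacyc φ).2 (hAv hw)
    obtain ⟨g, hgA, hgB⟩ := hwdh.exists_aut_glue hacyc
      ((finite_walkLayer hout j v).insert v)
      ((finite_walkLayer hout j c).sdiff (t := D.walkLayer j v)) φ τ
      (Set.disjoint_left.2 fun w hw hw' => by
        obtain ⟨d, hd, hwd⟩ := mem_descSet.1 hw'
        exact Set.disjoint_left.1 (hsep.1 d hd.1 hd.2) hwd (descSet_subset_desc hacyc hAv hw))
      (he.mono (descSet_subset_desc hacyc hAφ) (descSet_subset_desc hacyc hBc))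
    refine ⟨g, hgA v (.inl rfl), fun w hw => hgA w (.inr hw), fun w hw hw' => ?_⟩
    rw [hgB w ⟨hw, hw'⟩]
    exact hBc ⟨w, ⟨hw, hw'⟩, rfl⟩
  obtain ⟨φ, rfl⟩ := hwdh.1 v e₀
  -- Two copies of `c` are built over the same image `φ v`, the second twisted by `σ`. As `σ` sends
  -- `φ d` to `φ p`, the vertex `φ p` drops out of the second copy's layer.
  obtain ⟨σ, hσv, hσp⟩ := hdist.exists_aut_of_mem_walkLayer hacyc hout
    ((map_mem_walkLayer φ).2 hdv) ((map_mem_walkLayer φ).2 hpv)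
  obtain ⟨g, hgv, hgw, hgc⟩ := hglue φ e₁ h₀₁
  obtain ⟨h, hhv, hhw, hhc⟩ := hglue (φ.trans σ) e₂ (by simpa [hσv] using h₀₂)
  simp only [RelIso.trans_apply, hσv] at hhv hhw
  -- One half of separation, stated for general `g`, `h` so that it can be used in both orders.
  have aux : ∀ (g h : D.Aut) (e₁ e₂ : V), g v = φ v → h v = φ v →
      Disjoint (D.desc (φ v)) (D.desc e₁) → Disjoint (D.desc e₁) (D.desc e₂) →
      (∀ w ∈ D.walkLayer j c, w ∉ D.walkLayer j v → g w ∈ D.desc e₁) →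
      (∀ w ∈ D.walkLayer j c, w ∉ D.walkLayer j v → h w ∈ D.desc e₂) →
      ∀ w ∈ D.walkLayer j (g c), w ∉ D.walkLayer j (h c) →
        Disjoint (D.desc w) (D.desc (h c)) := by
    intro g h e₁ e₂ hgv hhv h₀₁ h₁₂ hgc hhc w hw hwh
    obtain ⟨w, rfl⟩ := g.surjective w
    have hwc := (map_mem_walkLayer g).1 hw
    by_cases hwv : w ∈ D.walkLayer j v
    · have hgw := (map_mem_walkLayer g).2 hwv
      rw [hgv, ← hhv] at hgw
      obtain ⟨w', hw'⟩ := h.surjective (g w)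
      rw [← hw', map_mem_walkLayer] at hgw hwh
      rw [← hw', Set.disjoint_left]
      intro z hz hz'
      obtain ⟨z, rfl⟩ := h.surjective z
      rw [map_mem_desc hacyc] at hz hz'
      exact Set.disjoint_left.1 (hsep.2 w' hgw hwh) hz hz'
    -- Here `g w` lies in `desc e₁`, whereas the layer of `h c` lies in `desc (φ v)` and `desc e₂`.
    · refine Set.disjoint_left.2 fun z hz hz' => ?_
      obtain ⟨q, hq, y, hyq, hyz⟩ := exists_mem_walkLayer_of_mem_desc hacyc hm hout hz' j
      have hy₁ : y ∈ D.desc e₁ := desc_closed hacyc (hgc w hwc hwv) (desc_closed hacyc hz hyz)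
      obtain ⟨q, rfl⟩ := h.surjective q
      by_cases hqv : q ∈ D.walkLayer j v
      · have hhq := (map_mem_walkLayer h).2 hqv
        rw [hhv] at hhq
        exact Set.disjoint_left.1 h₀₁
          (desc_closed hacyc (walkLayer_subset_desc hacyc _ _ hhq) hyq) hy₁
      · exact Set.disjoint_left.1 h₁₂ hy₁
          (desc_closed hacyc (hhc q ((map_mem_walkLayer h).1 hq) hqv) hyq)
  refine ⟨g c, h c, ?_, ⟨aux h g e₂ e₁ hhv hgv h₀₂ h₁₂.symm hhc hgc,
    aux g h e₁ e₂ hgv hhv h₀₁ h₁₂ hgc hhc⟩, ?_⟩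
  · have hg := hvc.map g
    have hh := hvc.map h
    rw [hgv] at hg
    rw [hhv] at hh
    exact hg.symm.trans hh
  · have hmemφ : ∀ w ∈ D.walkLayer j v, φ w ∈ D.desc (φ v) := fun w hw =>
      (map_mem_desc hacyc φ).2 (walkLayer_subset_desc hacyc _ _ hw)
    have hmemσ : ∀ w ∈ D.walkLayer j v, σ (φ w) ∈ D.desc (φ v) := fun w hw => by
      have := (map_mem_desc hacyc σ).2 (hmemφ w hw)
      rwa [hσv] at this
    -- The new overlap is contained in the `φ`-image of the old one, since the parts in `desc e₁`
    -- and `desc e₂` meet neither each other nor `desc (φ v)`; it misses `φ p`.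
    rw [← Set.ncard_image_of_injective (D.walkLayer j v ∩ D.walkLayer j c) φ.injective]
    refine Set.ncard_lt_ncard ⟨fun w hw => ?_, fun hsub => ?_⟩
      (((finite_walkLayer hout j v).inter_of_left _).image _)
    · obtain ⟨w, rfl⟩ := g.surjective w
      obtain ⟨w', hw'⟩ := h.surjective (g w)
      have hwc := (map_mem_walkLayer g).1 hw.1
      have hw'c := (map_mem_walkLayer h).1 (hw' ▸ hw.2)
      by_cases hwv : w ∈ D.walkLayer j v
      · exact ⟨w, ⟨hwv, hwc⟩, (hgw w hwv).symm⟩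
      · have h₁ := hgc w hwc hwv
        by_cases hw'v : w' ∈ D.walkLayer j v
        · have h₀ := hmemσ w' hw'v
          rw [← hhw w' hw'v, hw'] at h₀
          exact (Set.disjoint_left.1 h₀₁ h₀ h₁).elim
        · have h₂ := hhc w' hw'c hw'v
          rw [hw'] at h₂
          exact (Set.disjoint_left.1 h₁₂ h₁ h₂).elim
    · have hp := (hsub ⟨p, ⟨hpv, hpc⟩, rfl⟩).2
      rw [← hσp, ← hhw d hdv, map_mem_walkLayer] at hp
      exact hdc hp

theorem IsWeaklyDescendantHomogeneous.exists_sameIn_disjoint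
    (hwdh : D.IsWeaklyDescendantHomogeneous) (hacyc : D.NoDirectedCycles)
    (hdist : D.IsDistanceTransitive) {m : ℕ} (hm : 0 < m) (hout : D.HasOutValency m)
    {e₀ e₁ e₂ : V} (h₀₁ : Disjoint (D.desc e₀) (D.desc e₁))
    (h₀₂ : Disjoint (D.desc e₀) (D.desc e₂)) (h₁₂ : Disjoint (D.desc e₁) (D.desc e₂))
    {j : ℕ} {v c : V} (hvc : D.SameIn v c) (hsep : D.SeparatedAt j v c)
    (hlt : (D.walkLayer j v ∩ D.walkLayer j c).ncard < (D.walkLayer j v).ncard) :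
    ∃ x y, D.SameIn x y ∧ Disjoint (D.desc x) (D.desc y) := by
  induction hn : (D.walkLayer j v ∩ D.walkLayer j c).ncard using Nat.strong_induction_on
    generalizing v c with
  | _ n ih =>
    by_cases hne : (D.walkLayer j v ∩ D.walkLayer j c).Nonempty
    · obtain ⟨p, hpv, hpc⟩ := hne
      -- Strictness supplies `d`; it survives the induction because layers of equal depth have equal
      -- size.
      obtain ⟨d, hdv, hdc⟩ := Set.exists_mem_notMem_of_ncard_lt_ncard hlt
        ((finite_walkLayer hout j v).inter_of_left _)
      obtain ⟨v', c', hvc', hsep', hlt'⟩ := hwdh.exists_separatedAt_ncard_lt hacyc hdist hm hout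
        h₀₁ h₀₂ h₁₂ hvc hsep hpv hpc hdv fun h => hdc ⟨hdv, h⟩
      exact ih _ (hn ▸ hlt') hvc' hsep'
        (by rw [ncard_walkLayer_eq hwdh.1 j v' v]; exact hlt'.trans hlt) rfl
    · exact ⟨v, c, hvc, hsep.disjoint_desc hacyc hm hout
        (Set.disjoint_iff_inter_eq_empty.2 (Set.not_nonempty_iff_eq_empty.1 hne))⟩

end Digraph

theorem theorem4 {V : Type*} [Infinite V] (D : Digraph V) (hconn : D.IsConnected)
    (hdist : D.IsDistanceTransitive) (hwdh : D.IsWeaklyDescendantHomogeneous)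
    (m : ℕ) (hm : 0 < m) (hout : D.HasOutValency m) (hacyc : D.NoDirectedCycles)
    (α : V) (hP3 : (D.descSubdigraph α).P3 (D.descRoot α)) :
    D.HasInfiniteInValency ∧ D.ReachabilityIsUniversal ∧ ¬ D.HasPropertyZ := by
  have hlt := fun n u => D.ncard_walkLayer_lt hacyc hwdh.1 hout hP3 n u
  have hex := Digraph.exists_separatedAt hacyc hdist hm hout hwdh.1 hlt
  obtain ⟨k, x, y, hx, hy, hsep, z, hzy, hzx⟩ := hex α
  have hdisj : Disjoint (D.desc x) (D.desc z) := (hsep.1 z hzy hzx).symm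
  obtain ⟨z', hz'⟩ := Digraph.exists_adj hm hout z
  -- A second pair is taken below `z`, so that `x`, `x₁`, `z₁` have pairwise disjoint descendant
  -- sets.
  obtain ⟨k₁, x₁, y₁, hx₁, hy₁, hsep₁, z₁, hzy₁, hzx₁⟩ := hex z
  have hx₁z := Digraph.mem_desc_of_adj hacyc hx₁
  have hz₁z : z₁ ∈ D.desc z := Digraph.desc_closed hacyc (Digraph.mem_desc_of_adj hacyc hy₁)
    (Digraph.walkLayer_subset_desc hacyc _ _ hzy₁)
  obtain ⟨a, b, hab, habd⟩ := hwdh.exists_sameIn_disjoint hacyc hdist hm hout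
    (hdisj.mono_right (Digraph.desc_subset_desc hacyc hx₁z))
    (hdisj.mono_right (Digraph.desc_subset_desc hacyc hz₁z)) (hsep₁.1 z₁ hzy₁ hzx₁).symm
    (⟨α, α, hx, hy, .of_tail hx hy⟩ : D.SameIn x y) hsep (by
      rw [Digraph.ncard_walkLayer_eq hwdh.1 k x y]
      exact Set.ncard_lt_ncard ⟨Set.inter_subset_right, fun h => hzx (h hzy).1⟩
        (Digraph.finite_walkLayer hout k y))
  exact ⟨hwdh.hasInfiniteInValency hacyc hdist hconn hm hout hdisj,
    hwdh.reachabilityIsUniversal hacyc hdist hconn hm hout habd hab,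
    hwdh.not_hasPropertyZ hacyc hconn hz' hdisj⟩
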